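/- Let $G=(V,E)$ be a ribbon graph with finitely many vertices and edges (possibly disconnected, possibly non-orientable), that is, a surface with boundary represented as a union of a set $V$ of disjoint discs (vertices) and a set $E$ of disjoint discs (edges), where vertices and edges meet in disjoint line segments, each lying on the boundary of precisely one vertex and precisely one edge, and every edge contains exactly two of these segments; ribbon graphs are considered up to homeomorphisms preserving this structure, so that $G$ is described by a signed rotation system. For $A\subseteq E$ let $f(A)$ be the number of boundary components of the spanning ribbon subgraph $(V,A)$, and let $k(A)$ be its number of connected components; put $k(G)=k(E)$. For an integer $n\ge 0$ the $n$-spread $D_{\le n}(G)$ and the $n$-toggle $D_n(G)$ are the set systems with ground set $E$ and families of feasible sets $$\mathcal F_{\le n}(G)=\{A\subseteq E : f(A)\le k(G)+n\},\qquad \mathcal F_n(G)=\{A\subseteq E : f(A)=k(G)+n\}.$$ A delta-matroid is a pair $(E,\mathcal F)$ with $E$ a finite set and $\mathcal F$ a non-empty family of subsets of $E$ such that for all $X,Y\in\mathcal F$ and every $u\in X\bigtriangleup Y$ there is $v\in X\bigtriangleup Y$ (possibly $v=u$) with $X\bigtriangleup\{u,v\}\in\mathcal F$. Then: 1. for every $n\ge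 0$, $D_{\le n}(G)$ is a delta-matroid; 2. if $G$ has at least one edge and is orientable (as a surface), then $D_1(G)$ is a delta-matroid; 3. the feasible sets of $D_{\le 0}(G)$ are exactly the edge sets $A$ of the spanning quasi-trees of $G$, i.e. those $A$ for which $k(A)=k(G)$ and every connected component of $(V,A)$ has exactly one boundary component; in particular, by 1, the edge sets of the spanning quasi-trees of $G$ are the feasible sets of a delta-matroid. -/

import Mathlib

open scoped symmDiff

/-- A set system `(E, 𝓕)`; the ground set is the type `E`. -/
structure SetSystem (E : Type*) where
  /-- The feasible sets. -/
  Feasible : Set (Set E)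

/-- A delta-matroid: a proper set system on a finite ground set that satisfies the
Symmetric Exchange Axiom (in which `v = u` is allowed). -/
structure SetSystem.IsDeltaMatroid {E : Type*} (D : SetSystem E) : Prop where
  finite : Finite E
  proper : D.Feasible.Nonempty
  exchange : ∀ X ∈ D.Feasible, ∀ Y ∈ D.Feasible, ∀ u ∈ X ∆ Y,
    ∃ v ∈ X ∆ Y, X ∆ {u, v} ∈ D.Feasible

/-- A (not necessarily orientable, not necessarily connected) ribbon graph with vertex discs `V`
and edge discs `E`, given by its signed rotation system.

The edge disc `e` meets the vertex discs in two line segments, the half-edges `(e, false)` and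
`(e, true)`.  An orientation is chosen on the boundary circle of every vertex disc; `next h` is the
half-edge that follows `h` on that circle, so that the half-edges on one vertex disc form exactly
one cycle of `next`.  A vertex disc may carry no half-edge at all.  The ribbon `e` is `twisted` if
it does not respect the chosen orientations at its two ends. -/
structure RibbonGraph (V E : Type*) where
  /-- The vertex disc on whose boundary the half-edge lies. -/
  vert : E × Bool → V
  /-- The rotation: the next half-edge around the vertex disc. -/
  next : Equiv.Perm (E × Bool)
  /-- The half-edges on one vertex disc form a single cycle of the rotation. -/
  vert_eq_iff : ∀ h h' : E × Bool, vert h = vert h' ↔ next.SameCycle h h'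
  /-- Whether the ribbon has a half-twist. -/
  twisted : E → Bool

namespace RibbonGraph

variable {V E : Type*} (G : RibbonGraph V E)

/-- Two vertex discs are joined by an edge disc in `A`. -/
def JoinedBy (A : Set E) (u v : V) : Prop :=
  ∃ e ∈ A, G.vert (e, false) = u ∧ G.vert (e, true) = v

/-- The connected components of the spanning ribbon subgraph `(V, A)`. -/
def Component (A : Set E) : Type _ := Quot (G.JoinedBy A)

/-- `k(A)`: the number of connected components of `(V, A)`. -/
noncomputable def numComponents (A : Set E) : ℕ := Nat.card (G.Component A)

/-- Marked points on the boundaries of the discs.  The corners are the end points of the line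
segments in which the discs meet: with respect to the orientation of the vertex disc, the segment
`h` runs from `(h, false)` to `(h, true)`.  In addition, one point is marked on the boundary
circle of every vertex disc that carries no segment. -/
abbrev BoundaryPoint : Type _ := ((E × Bool) × Bool) ⊕ {v : V // ∀ h, G.vert h ≠ v}

/-- The vertex disc on which a marked point lies. -/
def BoundaryPoint.vertex : G.BoundaryPoint → V
  | Sum.inl (h, _) => G.vert h
  | Sum.inr v => v.1

/-- The arcs between corners that make up the boundary of the surface `(V, A)`, that is, of the
union of all vertex discs with the edge discs in `A`. -/
inductive BoundaryArc (A : Set E) : G.BoundaryPoint → G.BoundaryPoint → Prop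
  /-- The arc of a vertex circle from the end of a segment to the start of the next one. -/
  | gap (h : E × Bool) :
      BoundaryArc A (Sum.inl (h, true)) (Sum.inl (G.next h, false))
  /-- A segment at which the edge disc has been removed. -/
  | segment (h : E × Bool) (hA : h.1 ∉ A) :
      BoundaryArc A (Sum.inl (h, false)) (Sum.inl (h, true))
  /-- A side of an edge disc in `A`: an untwisted ribbon joins the start of each of its segments
  to the end of the other one, a twisted ribbon joins start to start and end to end. -/
  | side (e : E) (b : Bool) (hA : e ∈ A) :
      BoundaryArc A (Sum.inl ((e, false), b))
        (Sum.inl ((e, true), if G.twisted e then b else !b))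

/-- The boundary components of the surface `(V, A)`. -/
def BoundaryComponent (A : Set E) : Type _ := Quot (G.BoundaryArc A)

/-- `f(A)`: the number of boundary components of `(V, A)`. -/
noncomputable def numBoundary (A : Set E) : ℕ := Nat.card (G.BoundaryComponent A)

/-- The boundary component `b` of `(V, A)` lies on the connected component `c` of `(V, A)`. -/
def LiesOn (A : Set E) (b : G.BoundaryComponent A) (c : G.Component A) : Prop :=
  ∃ p : G.BoundaryPoint, Quot.mk _ p = b ∧ Quot.mk _ (BoundaryPoint.vertex G p) = c

/-- `(V, A)` is a spanning quasi-tree of `G`: it has as many connected components as `G`, and each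
of them has exactly one boundary component. -/
def IsSpanningQuasiTree (A : Set E) : Prop :=
  G.numComponents A = G.numComponents Set.univ ∧
    ∀ c : G.Component A, ∃! b : G.BoundaryComponent A, G.LiesOn A b c

/-- `G` is orientable: after reversing the orientations of some vertex discs (those with
`r v = true`), every ribbon respects the orientations at its two ends.  Reversing a vertex disc
changes the twist of a ribbon once for each of its ends on that disc. -/
def Orientable : Prop :=
  ∃ r : V → Bool, ∀ e : E,
    xor (G.twisted e) (xor (r (G.vert (e, false))) (r (G.vert (e, true)))) = false

/-- The `n`-spread `D_{≤ n}(G)`. -/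
def spread (n : ℕ) : SetSystem E where
  Feasible := {A | G.numBoundary A ≤ G.numComponents Set.univ + n}

/-- The `n`-toggle `D_n(G)`. -/
def toggle (n : ℕ) : SetSystem E where
  Feasible := {A | G.numBoundary A = G.numComponents Set.univ + n}

end RibbonGraph

/-!
Mark the four end points (corners) of the two segments of every edge disc. The boundary of `(V, A)`
joins the corners by two perfect matchings: the gaps on the vertex circles, which do not depend on
`A`, and the segments and ribbon sides. Toggling `e` changes the second matching on the four corners
of `e` only. If these corners lie on two boundary components, toggling merges the two into one; it
never splits a component into more than two. Hence `f` changes by at most one under a toggle. If no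
toggle of an edge of `X ∆ Y` lowers `f(X)`, then the corners of each such edge lie on one component
of `(V, X)`, so that every component of `(V, Y)` is contained in one of `(V, X)` and
`f(X) ≤ f(Y)`. These two properties give the exchange axiom for sublevel sets.

In an orientable `G`, the corners have a 2-colouring that changes along every arc. Going two arcs
forward is then a permutation whose cycles on one colour class are the boundary components, and a
toggle composes it with a transposition there, so that `f` always changes.
-/

section SymmDiff

variable {α : Type*}

theorem mem_symmDiff_singleton_iff_of_ne {s : Set α} {a b : α} (h : a ≠ b) :
    a ∈ s ∆ {b} ↔ a ∈ s := by
  simp [Set.mem_symmDiff, h]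

theorem mem_symmDiff_singleton_self {s : Set α} {a : α} : a ∈ s ∆ {a} ↔ a ∉ s := by
  simp [Set.mem_symmDiff]

theorem symmDiff_pair_of_ne (s : Set α) {a b : α} (h : a ≠ b) :
    s ∆ {a, b} = (s ∆ {a}) ∆ {b} := by
  rw [symmDiff_assoc, (Set.disjoint_singleton.2 h).symmDiff_eq_sup]
  rfl

theorem symmDiff_singleton_symmDiff_of_mem {s t : Set α} {a : α} (h : a ∈ s ∆ t) :
    (s ∆ {a}) ∆ t = (s ∆ t) \ {a} := by
  rw [symmDiff_right_comm, symmDiff_of_ge (Set.singleton_subset_iff.2 h)]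

end SymmDiff

namespace SetSystem

variable {E : Type*} [Finite E]

theorem isDeltaMatroid_of_symmDiff_singleton {D : SetSystem E} (hproper : D.Feasible.Nonempty)
    (hexchange : ∀ X ∈ D.Feasible, ∀ Y ∈ D.Feasible, ∀ u ∈ X ∆ Y, X ∆ {u} ∈ D.Feasible ∨
      ∃ v ∈ (X ∆ {u}) ∆ Y, (X ∆ {u}) ∆ {v} ∈ D.Feasible) : D.IsDeltaMatroid where
  finite := ‹_›
  proper := hproper
  exchange X hX Y hY u hu := by
    rcases hexchange X hX Y hY u hu with h | ⟨v, hv, h⟩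
    · exact ⟨u, hu, by rwa [Set.pair_eq_singleton]⟩
    · rw [symmDiff_singleton_symmDiff_of_mem hu] at hv
      exact ⟨v, hv.1, by rwa [symmDiff_pair_of_ne X (Ne.symm hv.2)]⟩

variable {f : Set E → ℕ} {m : ℕ}

theorem isDeltaMatroid_sublevel (hne : ∃ A, f A ≤ m)
    (hstep : ∀ A e, f (A ∆ {e}) ≤ f A + 1)
    (hdescent : ∀ X Y, f Y < f X → ∃ e ∈ X ∆ Y, f (X ∆ {e}) < f X) :
    (SetSystem.mk {A | f A ≤ m}).IsDeltaMatroid := by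
  refine isDeltaMatroid_of_symmDiff_singleton hne fun X (hX : f X ≤ m) Y (hY : f Y ≤ m) u _ => ?_
  by_cases hXu : f (X ∆ {u}) ≤ m
  · exact Or.inl hXu
  · obtain ⟨v, hv, hlt⟩ := hdescent (X ∆ {u}) Y (by lia)
    have := hstep X u
    have hXuv : f ((X ∆ {u}) ∆ {v}) ≤ m := by lia
    exact Or.inr ⟨v, hv, hXuv⟩

theorem isDeltaMatroid_level_succ [Nonempty E] (hmin : ∀ A, m ≤ f A) (hattained : ∃ A, f A = m)
    (hstep : ∀ A e, f (A ∆ {e}) ≤ f A + 1) (hchange : ∀ A e, f (A ∆ {e}) ≠ f A)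
    (hdescent : ∀ X Y, f Y < f X → ∃ e ∈ X ∆ Y, f (X ∆ {e}) < f X) :
    (SetSystem.mk {A | f A = m + 1}).IsDeltaMatroid := by
  have hleave_min : ∀ A e, f A = m → f (A ∆ {e}) = m + 1 := by
    intro A e hA
    have := hmin (A ∆ {e})
    have := hstep A e
    have := hchange A e
    lia
  obtain ⟨A, hA⟩ := hattained
  have hproper : {A | f A = m + 1}.Nonempty := ⟨A ∆ {Classical.arbitrary E}, hleave_min _ _ hA⟩
  refine isDeltaMatroid_of_symmDiff_singleton hproper
    fun X (hX : f X = m + 1) Y (hY : f Y = m + 1) u _ => Or.inr ?_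
  rcases (hchange X u).lt_or_gt with hlt | hgt
  · have hXu : f (X ∆ {u}) = m := by have := hmin (X ∆ {u}); lia
    have hne : X ∆ {u} ≠ Y := by rintro rfl; lia
    obtain ⟨v, hv⟩ := Set.symmDiff_nonempty.2 hne
    exact ⟨v, hv, hleave_min _ _ hXu⟩
  · obtain ⟨v, hv, hlt⟩ := hdescent (X ∆ {u}) Y (by lia)
    have hback := hstep ((X ∆ {u}) ∆ {v}) v
    rw [symmDiff_symmDiff_cancel_right] at hback
    have := hstep X u
    have hXuv : f ((X ∆ {u}) ∆ {v}) = m + 1 := by lia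
    exact ⟨v, hv, hXuv⟩

end SetSystem

section Involution

variable {α : Type*}

theorem even_card_of_involution {s : Finset α} {σ : α → α} (hmaps : ∀ x ∈ s, σ x ∈ s)
    (hinv : ∀ x ∈ s, σ (σ x) = x) (hne : ∀ x ∈ s, σ x ≠ x) : Even s.card := by
  have h : ∑ _x ∈ s, (1 : ZMod 2) = 0 :=
    Finset.sum_involution (fun x _ => σ x) (fun _ _ => by decide) (fun x hx _ => hne x hx)
      hmaps hinv
  rwa [Finset.sum_const, nsmul_one, ZMod.natCast_eq_zero_iff_even] at h

end Involution

section Perm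

open Equiv

variable {α : Type*} [Finite α]

theorem mem_of_sameCycle_of_mapsTo {f : Perm α} {s : Set α} {x y : α} (hs : Set.MapsTo f s s)
    (h : f.SameCycle x y) (hx : x ∈ s) : y ∈ s := by
  obtain ⟨n, -, -, rfl⟩ := h.exists_pow_eq''
  rw [← Perm.iterate_eq_pow]
  exact hs.iterate n hx

/-- Composing with a transposition of two points of a cycle splits this cycle: if `n` is minimal
with `f ^ n x = y`, then `x, f x, …, f ^ (n - 1) x` is a cycle of `g`. -/
theorem not_sameCycle_of_eq_swap_apply [DecidableEq α] {f g : Perm α} {x y : α} (hne : x ≠ y)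
    (hf : f.SameCycle x y) (hg : ∀ z, f.SameCycle x z → g z = swap x y (f z)) :
    ¬ g.SameCycle x y := by
  have hreach : ∃ n, (f ^ n) x = y := let ⟨n, _, _, hn⟩ := hf.exists_pow_eq''; ⟨n, hn⟩
  let n := Nat.find hreach
  have hn : (f ^ n) x = y := Nat.find_spec hreach
  have hbefore : ∀ j < n, (f ^ j) x ≠ y := fun j hj => Nat.find_min hreach hj
  have hn_pos : 0 < n := Nat.pos_of_ne_zero fun h => hne (by rw [h] at hn; exact hn)
  have hno_return : ∀ j < n, (f ^ (j + 1)) x ≠ x := fun j hj hx => by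
    refine hbefore (n - (j + 1)) (by lia) ?_
    calc (f ^ (n - (j + 1))) x = (f ^ (n - (j + 1))) ((f ^ (j + 1)) x) := by rw [hx]
      _ = (f ^ n) x := by rw [← Perm.mul_apply, ← pow_add, Nat.sub_add_cancel hj]
      _ = y := hn
  let initial : Set α := {z | ∃ j < n, (f ^ j) x = z}
  have hmaps : Set.MapsTo g initial initial := by
    rintro _ ⟨j, hj, rfl⟩
    rw [hg _ (Perm.sameCycle_pow_right.2 (Perm.SameCycle.refl f x)), ← Perm.mul_apply f,
      ← pow_succ']
    rcases Nat.lt_or_eq_of_le (Nat.succ_le_of_lt hj) with hlt | heq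
    · rw [swap_apply_of_ne_of_ne (hno_return j hj) (hbefore _ hlt)]
      exact ⟨j + 1, hlt, rfl⟩
    · rw [show j + 1 = n from heq, hn, swap_apply_right]
      exact ⟨0, hn_pos, rfl⟩
  intro h
  obtain ⟨j, hj, hjy⟩ := mem_of_sameCycle_of_mapsTo hmaps h ⟨0, hn_pos, rfl⟩
  exact hbefore j hj hjy

end Perm

namespace RibbonGraph

/-- A corner: an end point of a segment in which an edge disc meets a vertex disc. The corner
`(h, false)` is the start and `(h, true)` the end of the segment `h`; these are the marked points
`Sum.inl _` of `RibbonGraph.BoundaryPoint`. -/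
abbrev Corner (E : Type*) : Type _ := (E × Bool) × Bool

/-- The edge disc at a corner. -/
abbrev Corner.edge {E : Type*} (x : Corner E) : E := x.1.1

variable {V E : Type*} (G : RibbonGraph V E)

section Arcs

/-- The other end of the gap of a vertex circle at a corner. -/
def gapPartner : Corner E → Corner E
  | (h, true) => (G.next h, false)
  | (h, false) => (G.next.symm h, true)

open Classical in
/-- The other end of the segment or ribbon side in the boundary of `(V, A)` at a corner. -/
noncomputable def edgePartner (A : Set E) (x : Corner E) : Corner E :=
  if x.edge ∈ A then ((x.edge, !x.1.2), if G.twisted x.edge then x.2 else !x.2) else (x.1, !x.2)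

theorem gapPartner_involutive : Function.Involutive G.gapPartner := by
  rintro ⟨h, _ | _⟩ <;> simp [gapPartner]

theorem gapPartner_snd (x : Corner E) : (G.gapPartner x).2 = !x.2 := by
  rcases x with ⟨h, _ | _⟩ <;> rfl

theorem gapPartner_ne (x : Corner E) : G.gapPartner x ≠ x := fun h =>
  Bool.not_ne_self x.2 ((G.gapPartner_snd x).symm.trans (congrArg Prod.snd h))

theorem vert_next (h : E × Bool) : G.vert (G.next h) = G.vert h :=
  (G.vert_eq_iff _ _).2 (Equiv.Perm.SameCycle.refl _ _).apply_left

theorem vert_gapPartner (x : Corner E) : G.vert (G.gapPartner x).1 = G.vert x.1 := by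
  rcases x with ⟨h, _ | _⟩
  · simpa [gapPartner] using (G.vert_next (G.next.symm h)).symm
  · exact G.vert_next h

theorem edge_edgePartner (A : Set E) (x : Corner E) : (G.edgePartner A x).edge = x.edge := by
  unfold edgePartner
  split_ifs <;> rfl

theorem edgePartner_involutive (A : Set E) : Function.Involutive (G.edgePartner A) := by
  rintro ⟨⟨e, s⟩, b⟩
  by_cases h : e ∈ A <;> by_cases t : G.twisted e <;> simp [edgePartner, h, t]

theorem edgePartner_ne (A : Set E) (x : Corner E) : G.edgePartner A x ≠ x := by
  rcases x with ⟨⟨e, s⟩, b⟩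
  by_cases h : e ∈ A <;> simp [edgePartner, h]

theorem edgePartner_congr {A B : Set E} {x : Corner E} (h : x.edge ∈ A ↔ x.edge ∈ B) :
    G.edgePartner A x = G.edgePartner B x := by
  classical simp only [edgePartner, propext h]

theorem edgePartner_symmDiff_of_ne (A : Set E) {e : E} {x : Corner E} (h : x.edge ≠ e) :
    G.edgePartner (A ∆ {e}) x = G.edgePartner A x :=
  G.edgePartner_congr (mem_symmDiff_singleton_iff_of_ne h)

theorem edgePartner_symmDiff_ne (A : Set E) (x : Corner E) :
    G.edgePartner (A ∆ {x.edge}) x ≠ G.edgePartner A x := by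
  rcases x with ⟨⟨e, s⟩, b⟩
  by_cases h : e ∈ A <;> simp [edgePartner, mem_symmDiff_singleton_self, h]

theorem edgePartner_comm (A B : Set E) (x : Corner E) :
    G.edgePartner A (G.edgePartner B x) = G.edgePartner B (G.edgePartner A x) := by
  rcases x with ⟨⟨e, s⟩, b⟩
  by_cases hA : e ∈ A <;> by_cases hB : e ∈ B <;> by_cases t : G.twisted e <;>
    simp [edgePartner, hA, hB, t]

/-- On the four corners of `e`, the arcs before and after toggling `e` generate a regular action
of the Klein four-group. -/
theorem eq_or_eq_edgePartner_of_edge_eq (A : Set E) {e : E} {x y : Corner E} (hx : x.edge = e)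
    (hy : y.edge = e) : y = x ∨ y = G.edgePartner A x ∨ y = G.edgePartner (A ∆ {e}) x ∨
      y = G.edgePartner A (G.edgePartner (A ∆ {e}) x) := by
  rcases x with ⟨⟨e', s⟩, b⟩
  rcases y with ⟨⟨e'', s'⟩, b'⟩
  obtain rfl : e' = e := hx
  obtain rfl : e'' = e' := hy
  by_cases h : e'' ∈ A <;> by_cases t : G.twisted e'' <;>
    cases s <;> cases b <;> cases s' <;> cases b' <;>
    simp [edgePartner, mem_symmDiff_singleton_self, h, t]

end Arcs

section CornerComponent

/-- The boundary component of `(V, A)` that passes through a corner. -/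
def cornerComponent (A : Set E) (x : Corner E) : G.BoundaryComponent A :=
  Quot.mk _ (Sum.inl x)

variable {G} {A : Set E}

theorem BoundaryArc.map_eq {β : Sort*} {F : G.BoundaryPoint → β}
    (hgap : ∀ x, F (Sum.inl (G.gapPartner x)) = F (Sum.inl x))
    (hedge : ∀ x, F (Sum.inl (G.edgePartner A x)) = F (Sum.inl x))
    {p q : G.BoundaryPoint} (h : G.BoundaryArc A p q) : F p = F q := by
  cases h with
  | gap h => exact (hgap (h, true)).symm
  | segment h hA => simpa [edgePartner, hA] using (hedge (h, false)).symm
  | side e b hA => simpa [edgePartner, hA] using (hedge ((e, false), b)).symm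

theorem cornerComponent_induction {P : Corner E → Prop} (hgap : ∀ x, P x → P (G.gapPartner x))
    (hedge : ∀ x, P x → P (G.edgePartner A x)) {x y : Corner E}
    (hxy : G.cornerComponent A x = G.cornerComponent A y) (hx : P x) : P y := by
  let F : G.BoundaryPoint → Prop := Sum.elim P fun _ => False
  have hgap_iff (z) : P (G.gapPartner z) = P z :=
    propext ⟨fun h => G.gapPartner_involutive z ▸ hgap _ h, hgap z⟩
  have hedge_iff (z) : P (G.edgePartner A z) = P z :=
    propext ⟨fun h => G.edgePartner_involutive A z ▸ hedge _ h, hedge z⟩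
  have hlift : ∀ p q, G.BoundaryArc A p q → F p = F q :=
    fun _ _ => BoundaryArc.map_eq hgap_iff hedge_iff
  exact (congrArg (Quot.lift F hlift) hxy).mp hx

variable (G) (A)

theorem cornerComponent_gapPartner (x : Corner E) :
    G.cornerComponent A (G.gapPartner x) = G.cornerComponent A x := by
  rcases x with ⟨h, _ | _⟩
  · have hgap : G.cornerComponent A (G.next.symm h, true) =
        G.cornerComponent A (G.next (G.next.symm h), false) := Quot.sound (.gap _)
    rwa [Equiv.apply_symm_apply] at hgap
  · exact (Quot.sound (BoundaryArc.gap h)).symm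

theorem cornerComponent_edgePartner (x : Corner E) :
    G.cornerComponent A (G.edgePartner A x) = G.cornerComponent A x := by
  have hsegment (h : E × Bool) (hA : h.1 ∉ A) :
      G.cornerComponent A (h, false) = G.cornerComponent A (h, true) :=
    Quot.sound (.segment h hA)
  have hside (e : E) (b : Bool) (hA : e ∈ A) : G.cornerComponent A ((e, false), b) =
      G.cornerComponent A ((e, true), if G.twisted e then b else !b) :=
    Quot.sound (.side e b hA)
  rcases x with ⟨⟨e, s⟩, b⟩
  by_cases hA : e ∈ A
  · by_cases t : G.twisted e <;> cases s <;> simp [edgePartner, hA, t, hside]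
  · cases b <;> simp [edgePartner, hA, hsegment]

end CornerComponent

section OneSided

/-- All corners of the edge disc `e` lie on one boundary component of `(V, A)`. -/
def OneSided (A : Set E) (e : E) : Prop :=
  ∀ x y : Corner E, x.edge = e → y.edge = e → G.cornerComponent A x = G.cornerComponent A y

variable {G} {A : Set E} {e : E}

theorem oneSided_of_cornerComponent_eq {x : Corner E} (hx : x.edge = e)
    (h : G.cornerComponent A (G.edgePartner (A ∆ {e}) x) = G.cornerComponent A x) :
    G.OneSided A e := by
  have hall (y : Corner E) (hy : y.edge = e) : G.cornerComponent A y = G.cornerComponent A x := by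
    rcases G.eq_or_eq_edgePartner_of_edge_eq A hx hy with rfl | rfl | rfl | rfl
    · rfl
    · exact G.cornerComponent_edgePartner A x
    · exact h
    · rw [cornerComponent_edgePartner, h]
  exact fun y z hy hz => (hall y hy).trans (hall z hz).symm

/-- If the corners of each edge of `X ∆ Y` lie on one boundary component of `(V, X)`, then every
boundary component of `(V, Y)` is contained in one of `(V, X)`. -/
def collapse {X Y : Set E} (h : ∀ e ∈ X ∆ Y, G.OneSided X e) :
    G.BoundaryComponent Y → G.BoundaryComponent X :=
  Quot.lift (Quot.mk _) fun _ _ hpq => hpq.map_eq (G.cornerComponent_gapPartner X) fun x => by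
    by_cases hx : x.edge ∈ X ∆ Y
    · exact h _ hx _ _ (G.edge_edgePartner Y x) rfl
    · have hXY : x.edge ∈ X ↔ x.edge ∈ Y := by rw [Set.mem_symmDiff] at hx; tauto
      rw [← G.edgePartner_congr hXY]
      exact G.cornerComponent_edgePartner X x

theorem collapse_surjective {X Y : Set E} (h : ∀ e ∈ X ∆ Y, G.OneSided X e) :
    Function.Surjective (collapse h) :=
  Quot.ind fun p => ⟨Quot.mk _ p, rfl⟩

/-- Otherwise `x` would be the only corner of `e` that lies on both the component of `x` in
`(V, A)` and that in `(V, A ∆ {e})`. The gaps match the corners common to these two components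
perfectly, but the other arcs match all of them except `x`, which contradicts parity. -/
theorem cornerComponent_symmDiff_of_not_oneSided [Finite E] (h : ¬ G.OneSided A e)
    {x : Corner E} (hx : x.edge = e) :
    G.cornerComponent (A ∆ {e}) (G.edgePartner A x) = G.cornerComponent (A ∆ {e}) x := by
  classical
  by_contra hsplit
  have := Fintype.ofFinite E
  let s : Finset (Corner E) := {y | G.cornerComponent A y = G.cornerComponent A x ∧
    G.cornerComponent (A ∆ {e}) y = G.cornerComponent (A ∆ {e}) x}
  have mem_s (y) : y ∈ s ↔ G.cornerComponent A y = G.cornerComponent A x ∧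
      G.cornerComponent (A ∆ {e}) y = G.cornerComponent (A ∆ {e}) x := by simp [s]
  have eq_x_of_edge_eq (y) (hy : y ∈ s) (hye : y.edge = e) : y = x := by
    rw [mem_s] at hy
    rcases G.eq_or_eq_edgePartner_of_edge_eq A hx hye with rfl | rfl | rfl | rfl
    · rfl
    · exact absurd hy.2 hsplit
    · exact absurd (oneSided_of_cornerComponent_eq hx hy.1) h
    · rw [cornerComponent_edgePartner] at hy
      exact absurd (oneSided_of_cornerComponent_eq hx hy.1) h
  have even_card : Even s.card := even_card_of_involution (σ := G.gapPartner)
    (fun y hy => by simpa only [mem_s, cornerComponent_gapPartner] using hy)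
    (fun y _ => G.gapPartner_involutive y) (fun y _ => G.gapPartner_ne y)
  have even_card_erase : Even (s.erase x).card := by
    refine even_card_of_involution (σ := G.edgePartner A) (fun y hy => ?_)
      (fun y _ => G.edgePartner_involutive A y) (fun y _ => G.edgePartner_ne A y)
    obtain ⟨hyx, hys⟩ := Finset.mem_erase.1 hy
    have hye : y.edge ≠ e := fun hye => hyx (eq_x_of_edge_eq y hys hye)
    refine Finset.mem_erase.2 ⟨fun hc => hye ?_, ?_⟩
    · rw [← G.edge_edgePartner A y, hc, hx]
    · rw [mem_s] at hys ⊢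
      rw [cornerComponent_edgePartner, ← G.edgePartner_symmDiff_of_ne A hye,
        cornerComponent_edgePartner]
      exact hys
  have hx_mem : x ∈ s := (mem_s x).2 ⟨rfl, rfl⟩
  rw [← Finset.card_erase_add_one hx_mem, Nat.even_add_one] at even_card
  exact even_card even_card_erase

theorem oneSided_symmDiff_of_not_oneSided [Finite E] (h : ¬ G.OneSided A e) :
    G.OneSided (A ∆ {e}) e := by
  have hx : Corner.edge ((e, false), false) = e := rfl
  refine oneSided_of_cornerComponent_eq hx ?_
  rw [symmDiff_symmDiff_cancel_right]
  exact cornerComponent_symmDiff_of_not_oneSided h hx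

end OneSided

section NumBoundary

instance [Finite V] [Finite E] (A : Set E) : Finite (G.BoundaryComponent A) :=
  Finite.of_surjective (Quot.mk _) Quot.mk_surjective

variable [Finite V] [Finite E]

variable {G} in
theorem numBoundary_le_of_oneSided {X Y : Set E} (h : ∀ e ∈ X ∆ Y, G.OneSided X e) :
    G.numBoundary X ≤ G.numBoundary Y :=
  Nat.card_le_card_of_surjective _ (collapse_surjective h)

variable {G} in
theorem numBoundary_symmDiff_lt {A : Set E} {e : E} (h : ¬ G.OneSided A e) :
    G.numBoundary (A ∆ {e}) < G.numBoundary A := by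
  have honeSided := oneSided_symmDiff_of_not_oneSided h
  have hdiff : ∀ e' ∈ (A ∆ {e}) ∆ A, G.OneSided (A ∆ {e}) e' := by
    rw [symmDiff_comm, symmDiff_symmDiff_cancel_left]
    rintro _ rfl
    exact honeSided
  refine (numBoundary_le_of_oneSided hdiff).lt_of_ne fun hcard => h ?_
  have hbij := (collapse_surjective hdiff).bijective_of_nat_card_le hcard.ge
  exact fun x y hx hy => hbij.1 (honeSided x y hx hy)

theorem numBoundary_le_symmDiff_add_one (A : Set E) (e : E) :
    G.numBoundary A ≤ G.numBoundary (A ∆ {e}) + 1 := by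
  classical
  let x : Corner E := ((e, false), false)
  let a := G.cornerComponent A x
  let c := G.cornerComponent A (G.edgePartner (A ∆ {e}) x)
  -- After identifying the (at most two) components at `e`, the arcs of `A ∆ {e}` respect them.
  let merge : G.BoundaryComponent A → G.BoundaryComponent A := Function.update id c a
  have hmerge (y : Corner E) (hy : y.edge = e) : merge (G.cornerComponent A y) = a := by
    have hcomponent : G.cornerComponent A y = a ∨ G.cornerComponent A y = c := by
      rcases G.eq_or_eq_edgePartner_of_edge_eq A (e := e) (x := x) rfl hy with h | h | h | h <;>
        simp only [h, cornerComponent_edgePartner, a, c, true_or, or_true]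
    rcases hcomponent with h | h <;> simp [merge, h, Function.update_apply]
  have harc (p q) (hpq : G.BoundaryArc (A ∆ {e}) p q) :
      merge (Quot.mk _ p) = merge (Quot.mk _ q) := by
    refine hpq.map_eq (F := fun p => merge (Quot.mk _ p))
      (fun y => congrArg merge (G.cornerComponent_gapPartner A y)) fun y => ?_
    by_cases hy : y.edge = e
    · exact (hmerge _ ((G.edge_edgePartner _ y).trans hy)).trans (hmerge y hy).symm
    · rw [G.edgePartner_symmDiff_of_ne A hy]
      exact congrArg merge (G.cornerComponent_edgePartner A y)
  let cover (o : Option (G.BoundaryComponent (A ∆ {e}))) : G.BoundaryComponent A :=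
    o.elim c (Quot.lift (fun p => merge (Quot.mk _ p)) harc)
  have hcover : Function.Surjective cover := by
    refine Quot.ind fun p => ?_
    by_cases hp : Quot.mk _ p = c
    · exact ⟨none, hp.symm⟩
    · refine ⟨some (Quot.mk _ p), ?_⟩
      exact Function.update_of_ne hp a id
  calc Nat.card (G.BoundaryComponent A) ≤ Nat.card (Option (G.BoundaryComponent (A ∆ {e}))) :=
        Nat.card_le_card_of_surjective cover hcover
    _ = G.numBoundary (A ∆ {e}) + 1 := Finite.card_option

theorem numBoundary_symmDiff_le (A : Set E) (e : E) :
    G.numBoundary (A ∆ {e}) ≤ G.numBoundary A + 1 := by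
  simpa only [symmDiff_symmDiff_cancel_right] using G.numBoundary_le_symmDiff_add_one (A ∆ {e}) e

theorem exists_numBoundary_symmDiff_lt (X Y : Set E) (h : G.numBoundary Y < G.numBoundary X) :
    ∃ e ∈ X ∆ Y, G.numBoundary (X ∆ {e}) < G.numBoundary X := by
  by_contra! hno_descent
  refine h.not_ge (numBoundary_le_of_oneSided fun e he => ?_)
  by_contra hn
  exact (hno_descent e he).not_gt (numBoundary_symmDiff_lt hn)

end NumBoundary

section QuasiTree

/-- The connected component of `(V, A)` on which a boundary component lies. -/
def BoundaryComponent.component (A : Set E) : G.BoundaryComponent A → G.Component A :=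
  Quot.lift (fun p => Quot.mk _ (BoundaryPoint.vertex G p)) fun _ _ h => by
    cases h with
    | gap h => exact congrArg _ (G.vert_next h).symm
    | segment h hA => rfl
    | side e b hA => exact Quot.sound ⟨e, hA, rfl, rfl⟩

theorem BoundaryPoint.vertex_surjective : Function.Surjective (BoundaryPoint.vertex G) := by
  intro v
  by_cases! h : ∀ h, G.vert h ≠ v
  · exact ⟨Sum.inr ⟨v, h⟩, rfl⟩
  · obtain ⟨h, rfl⟩ := h
    exact ⟨Sum.inl (h, false), rfl⟩

theorem BoundaryComponent.component_surjective (A : Set E) :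
    Function.Surjective (BoundaryComponent.component G A) := by
  refine Quot.ind fun v => ?_
  obtain ⟨p, rfl⟩ := BoundaryPoint.vertex_surjective G v
  exact ⟨Quot.mk _ p, rfl⟩

theorem liesOn_iff_component_eq {A : Set E} {b : G.BoundaryComponent A} {c : G.Component A} :
    G.LiesOn A b c ↔ BoundaryComponent.component G A b = c := by
  constructor
  · rintro ⟨p, rfl, rfl⟩
    rfl
  · rintro rfl
    obtain ⟨p, rfl⟩ := Quot.mk_surjective b
    exact ⟨p, rfl, rfl⟩

instance [Finite V] (A : Set E) : Finite (G.Component A) :=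
  Finite.of_surjective (Quot.mk _) Quot.mk_surjective

theorem numComponents_antitone [Finite V] : Antitone G.numComponents := fun _ _ hAB =>
  Nat.card_le_card_of_surjective
    (Quot.lift (Quot.mk _) fun _ _ ⟨e, he, h⟩ => Quot.sound ⟨e, hAB he, h⟩)
    (Quot.ind fun v => ⟨Quot.mk _ v, rfl⟩)

variable {G} in
theorem cornerComponent_eq_of_vert_eq [Finite E] {A : Set E} (hone : ∀ e, G.OneSided A e)
    {x y : Corner E} (hxy : G.vert x.1 = G.vert y.1) :
    G.cornerComponent A x = G.cornerComponent A y := by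
  let s : Set (E × Bool) := {h | G.cornerComponent A (h, false) = G.cornerComponent A x}
  have hmaps : Set.MapsTo G.next s s := by
    intro h (hs : G.cornerComponent A (h, false) = G.cornerComponent A x)
    have hgap := G.cornerComponent_gapPartner A (h, true)
    exact hgap.trans ((hone h.1 _ _ rfl rfl).trans hs)
  have hy : y.1 ∈ s :=
    mem_of_sameCycle_of_mapsTo hmaps ((G.vert_eq_iff _ _).1 hxy) (hone x.edge _ _ rfl rfl)
  exact hy.symm.trans (hone y.edge _ _ rfl rfl)

variable {G} in
theorem mk_boundaryArc_eq_of_vertex_eq [Finite E] {A : Set E} (hone : ∀ e, G.OneSided A e) :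
    ∀ {p q : G.BoundaryPoint}, BoundaryPoint.vertex G p = BoundaryPoint.vertex G q →
      Quot.mk (G.BoundaryArc A) p = Quot.mk _ q
  | Sum.inl _, Sum.inl _, hpq => cornerComponent_eq_of_vert_eq hone hpq
  | Sum.inl x, Sum.inr v, hpq => absurd hpq (v.2 x.1)
  | Sum.inr v, Sum.inl x, hpq => absurd hpq.symm (v.2 x.1)
  | Sum.inr _, Sum.inr _, hpq => congrArg _ (congrArg _ (Subtype.ext hpq))

variable [Finite V] [Finite E]

theorem numComponents_le_numBoundary (A : Set E) : G.numComponents A ≤ G.numBoundary A :=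
  Nat.card_le_card_of_surjective _ (BoundaryComponent.component_surjective G A)

theorem numComponents_univ_le_numBoundary (A : Set E) :
    G.numComponents Set.univ ≤ G.numBoundary A :=
  (G.numComponents_antitone (Set.subset_univ A)).trans (G.numComponents_le_numBoundary A)

theorem numBoundary_le_iff_isSpanningQuasiTree {A : Set E} :
    G.numBoundary A ≤ G.numComponents Set.univ ↔ G.IsSpanningQuasiTree A := by
  have hcomponents := G.numComponents_antitone (Set.subset_univ A)
  have hboundary := G.numComponents_le_numBoundary A
  simp only [IsSpanningQuasiTree, liesOn_iff_component_eq, ← Function.bijective_iff_existsUnique]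
  constructor
  · intro h
    exact ⟨(hboundary.trans h).antisymm hcomponents,
      (BoundaryComponent.component_surjective G A).bijective_of_nat_card_le (h.trans hcomponents)⟩
  · rintro ⟨h, hbij⟩
    exact (Nat.card_eq_of_bijective _ hbij).trans_le h.le

variable {G} in
theorem numBoundary_eq_of_forall_oneSided {A : Set E} (hone : ∀ e, G.OneSided A e) :
    G.numBoundary A = G.numComponents Set.univ := by
  refine le_antisymm ?_ (G.numComponents_univ_le_numBoundary A)
  choose p hp using BoundaryPoint.vertex_surjective G
  have hjoin : ∀ u v, G.JoinedBy Set.univ u v →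
      Quot.mk (G.BoundaryArc A) (p u) = Quot.mk _ (p v) := by
    rintro _ _ ⟨e, -, rfl, rfl⟩
    have hcorner (s : Bool) : Quot.mk _ (p (G.vert (e, s))) = G.cornerComponent A ((e, s), false) :=
      mk_boundaryArc_eq_of_vertex_eq hone (hp _)
    exact (hcorner false).trans ((hone e _ _ rfl rfl).trans (hcorner true).symm)
  refine Nat.card_le_card_of_surjective (Quot.lift _ hjoin) (Quot.ind fun q => ?_)
  exact ⟨Quot.mk _ (BoundaryPoint.vertex G q), mk_boundaryArc_eq_of_vertex_eq hone (hp _)⟩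

theorem exists_numBoundary_eq : ∃ A : Set E, G.numBoundary A = G.numComponents Set.univ := by
  obtain ⟨A, hmin⟩ := Finite.exists_min G.numBoundary
  refine ⟨A, numBoundary_eq_of_forall_oneSided fun e => ?_⟩
  by_contra hn
  exact (hmin _).not_gt (numBoundary_symmDiff_lt hn)

end QuasiTree

section Orientable

/-- Walking along the boundary of `(V, A)` from a corner over a gap and then over a segment or
ribbon side. -/
noncomputable def boundaryStep (A : Set E) : Equiv.Perm (Corner E) :=
  (G.edgePartner_involutive A).toPerm * G.gapPartner_involutive.toPerm

theorem boundaryStep_apply (A : Set E) (x : Corner E) :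
    G.boundaryStep A x = G.edgePartner A (G.gapPartner x) := rfl

/-- A 2-colouring of the corners such that the two ends of every gap, segment and ribbon side have
different colours. It amounts to an orientation of the boundary of all spanning ribbon subgraphs. -/
structure IsAlternating (col : Corner E → Bool) : Prop where
  col_gapPartner : ∀ x, col (G.gapPartner x) = !col x
  col_edgePartner : ∀ A x, col (G.edgePartner A x) = !col x

variable {G}

theorem Orientable.exists_isAlternating (h : G.Orientable) :
    ∃ col : Corner E → Bool, G.IsAlternating col := by
  obtain ⟨r, hr⟩ := h
  refine ⟨fun x => xor x.2 (r (G.vert x.1)), fun x => ?_, fun A x => ?_⟩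
  · simp only [gapPartner_snd, vert_gapPartner, Bool.not_xor]
  · rcases x with ⟨⟨e, s⟩, b⟩
    have he := hr e
    by_cases hA : e ∈ A
    · cases s <;> cases b <;> cases ht : G.twisted e <;> cases hstart : r (G.vert (e, false)) <;>
        cases hend : r (G.vert (e, true)) <;> simp_all [edgePartner]
    · simp [edgePartner, hA]

namespace IsAlternating

variable {col : Corner E → Bool} {A : Set E}

theorem col_boundaryStep (h : G.IsAlternating col) (x : Corner E) :
    col (G.boundaryStep A x) = col x := by
  rw [boundaryStep_apply, h.col_edgePartner, h.col_gapPartner, Bool.not_not]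

theorem col_eq_of_sameCycle [Finite E] (h : G.IsAlternating col) {x y : Corner E}
    (hxy : (G.boundaryStep A).SameCycle x y) : col y = col x :=
  mem_of_sameCycle_of_mapsTo (s := {z | col z = col x})
    (fun z hz => (h.col_boundaryStep z).trans hz) hxy rfl

theorem sameCycle_boundaryStep (h : G.IsAlternating col) {x y : Corner E}
    (hcomponent : G.cornerComponent A x = G.cornerComponent A y) (hcol : col x = col y) :
    (G.boundaryStep A).SameCycle x y := by
  let P (z : Corner E) : Prop := (col z = col x → (G.boundaryStep A).SameCycle x z) ∧
    (col z ≠ col x → (G.boundaryStep A).SameCycle x (G.gapPartner z))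
  have hgap (z) (hz : P z) : P (G.gapPartner z) := by
    simp only [P, h.col_gapPartner, G.gapPartner_involutive z, Bool.not_eq, ne_eq, not_not]
    exact hz.symm
  have hedge (z) (hz : P z) : P (G.edgePartner A z) := by
    simp only [P, h.col_edgePartner, Bool.not_eq, ne_eq, not_not]
    refine ⟨fun hc => ?_, fun hc => ?_⟩
    · rw [← G.gapPartner_involutive z, ← boundaryStep_apply, Equiv.Perm.sameCycle_apply_right]
      exact hz.2 hc
    · rw [← Equiv.Perm.sameCycle_apply_right, boundaryStep_apply, G.gapPartner_involutive,
        G.edgePartner_involutive]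
      exact hz.1 hc
  have hx : P x := ⟨fun _ => .refl _ _, absurd rfl⟩
  exact (cornerComponent_induction hgap hedge hcomponent hx).1 hcol.symm

theorem edgePartner_symmDiff_edgePartner [DecidableEq E] (h : G.IsAlternating col)
    {x y : Corner E} (hcol : col y = col x) :
    G.edgePartner (A ∆ {x.edge}) (G.edgePartner A y) =
      Equiv.swap x (G.edgePartner (A ∆ {x.edge}) (G.edgePartner A x)) y := by
  by_cases hy : y.edge = x.edge
  · rcases G.eq_or_eq_edgePartner_of_edge_eq A rfl hy with rfl | rfl | rfl | rfl
    · rw [Equiv.swap_apply_left]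
    · simp [h.col_edgePartner] at hcol
    · simp [h.col_edgePartner] at hcol
    · rw [edgePartner_involutive, G.edgePartner_involutive _ x,
        G.edgePartner_comm, Equiv.swap_apply_right]
  · rw [edgePartner_symmDiff_of_ne, edgePartner_involutive, Equiv.swap_apply_of_ne_of_ne]
    · rintro rfl
      exact hy rfl
    · rintro rfl
      simp [edge_edgePartner] at hy
    · rwa [edge_edgePartner]

theorem not_oneSided_symmDiff [Finite E] (h : G.IsAlternating col) {e : E}
    (hone : G.OneSided A e) : ¬ G.OneSided (A ∆ {e}) e := by
  classical
  intro hone'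
  let x : Corner E := ((e, false), false)
  let y : Corner E := G.edgePartner (A ∆ {e}) (G.edgePartner A x)
  have hy : y.edge = e := by simp only [y, edge_edgePartner, x]
  have hcol : col x = col y := by simp only [y, h.col_edgePartner, Bool.not_not]
  have hne : x ≠ y := fun hxy => G.edgePartner_symmDiff_ne A x <| by
    rw [← G.edgePartner_involutive (A ∆ {e}) (G.edgePartner A x)]
    exact congrArg (G.edgePartner (A ∆ {e})) hxy
  refine not_sameCycle_of_eq_swap_apply hne
    (h.sameCycle_boundaryStep (hone x y rfl hy) hcol) (fun z hz => ?_)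
    (h.sameCycle_boundaryStep (hone' x y rfl hy) hcol)
  have hswap := h.edgePartner_symmDiff_edgePartner (A := A) (x := x) (y := G.boundaryStep A z)
    ((h.col_boundaryStep z).trans (h.col_eq_of_sameCycle hz))
  rwa [boundaryStep_apply, edgePartner_involutive] at hswap

end IsAlternating

theorem Orientable.numBoundary_symmDiff_ne [Finite V] [Finite E] (h : G.Orientable) (A : Set E)
    (e : E) : G.numBoundary (A ∆ {e}) ≠ G.numBoundary A := by
  obtain ⟨col, hcol⟩ := h.exists_isAlternating
  by_cases hone : G.OneSided A e
  · have hlt := numBoundary_symmDiff_lt (hcol.not_oneSided_symmDiff hone)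
    rw [symmDiff_symmDiff_cancel_right] at hlt
    exact hlt.ne'
  · exact (numBoundary_symmDiff_lt hone).ne

end Orientable

end RibbonGraph

theorem theoremt1 {V E : Type*} [Finite V] [Finite E] (G : RibbonGraph V E) :
    (∀ n : ℕ, (G.spread n).IsDeltaMatroid) ∧
    (Nonempty E → G.Orientable → (G.toggle 1).IsDeltaMatroid) ∧
    (∀ A : Set E, A ∈ (G.spread 0).Feasible ↔ G.IsSpanningQuasiTree A) := by
  obtain ⟨A, hA⟩ := G.exists_numBoundary_eq
  refine ⟨fun n => ?_, fun _ horientable => ?_, fun A => G.numBoundary_le_iff_isSpanningQuasiTree⟩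
  · exact SetSystem.isDeltaMatroid_sublevel ⟨A, hA.trans_le (Nat.le_add_right _ n)⟩
      G.numBoundary_symmDiff_le G.exists_numBoundary_symmDiff_lt
  · exact SetSystem.isDeltaMatroid_level_succ G.numComponents_univ_le_numBoundary ⟨A, hA⟩
      G.numBoundary_symmDiff_le horientable.numBoundary_symmDiff_ne G.exists_numBoundary_symmDiff_lt
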